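/- Let $\sigma_1,\sigma_2,\sigma_3$ be the Pauli matrices. A two-qubit state is a positive semidefinite matrix $\rho$ of trace $1$ on $\mathbb{C}^2\otimes\mathbb{C}^2$ (subsystems $A$ and $B$). For such $\rho$ put $A_i=\rho^{1/2}(\sigma_i\otimes 1)\rho^{1/2}$ for $i=1,2,3$, and for a right-unitary $4\times K$ complex matrix $T$ (that is, $TT^\dagger=1$, with any number $K$ of columns) put $$D(\rho,T)=\sum_{j=1}^{K}\Big(\sum_{i=1}^{3}\big|(T^\dagger A_iT)_{jj}\big|^2\Big)^{1/2},\qquad D(\rho)=\min_{T}D(\rho,T),$$ the minimum being over all $K$ and all right-unitary $4\times K$ matrices $T$. If $\rho$ is a two-qubit state of rank $2$, then the minimum defining $D(\rho)$ is attained and $$D(\rho)=\sqrt{2}\,\max\big(\|\mathrm{Tr}_A\rho-\tfrac12 1\|_2,\ \|\mathrm{Tr}_B\rho-\tfrac12 1\|_2\big),$$ where $\mathrm{Tr}_A,\mathrm{Tr}_B$ are the partial traces and $\|X\|_2=\sqrt{\mathrm{Tr}(X^\dagger X)}$ is the Hilbert-Schmidt norm. -/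

import Mathlib

open scoped Matrix Kronecker ComplexOrder MatrixOrder

/-- Operators on the Hilbert space `ℂ² ⊗ ℂ²` of two qubits `A` (first factor) and `B`
(second factor), as matrices in the product basis `|i, j⟩`. -/
abbrev TwoQubitMatrix : Type := Matrix (Fin 2 × Fin 2) (Fin 2 × Fin 2) ℂ

/-- A two-qubit state: a positive semidefinite matrix of trace one. -/
structure IsTwoQubitState (ρ : TwoQubitMatrix) : Prop where
  posSemidef : ρ.PosSemidef
  trace_eq_one : ρ.trace = 1

/-- The partial trace over the first qubit, `(Tr_A ρ)_{jl} = ∑_i ρ_{ij,il}`. -/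
def traceA (ρ : TwoQubitMatrix) : Matrix (Fin 2) (Fin 2) ℂ :=
  Matrix.of fun j l => ∑ i, ρ (i, j) (i, l)

/-- The partial trace over the second qubit, `(Tr_B ρ)_{ik} = ∑_j ρ_{ij,kj}`. -/
def traceB (ρ : TwoQubitMatrix) : Matrix (Fin 2) (Fin 2) ℂ :=
  Matrix.of fun i k => ∑ j, ρ (i, j) (k, j)

/-- The three Pauli matrices `σ_x, σ_y, σ_z`. -/
def pauli : Fin 3 → Matrix (Fin 2) (Fin 2) ℂ :=
  ![!![0, 1; 1, 0], !![0, -Complex.I; Complex.I, 0], !![1, 0; 0, -1]]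

/-- The Hilbert-Schmidt (Schatten 2-) norm `‖X‖₂ = √(Tr X†X)`. -/
noncomputable def hsNorm (X : Matrix (Fin 2) (Fin 2) ℂ) : ℝ :=
  Real.sqrt (Xᴴ * X).trace.re

/-- The matrices `A_i = ρ^{1/2} (σ_i ⊗ 1) ρ^{1/2}`, where `ρ^{1/2}` is the positive
semidefinite square root of `ρ`. -/
noncomputable def bigA (ρ : TwoQubitMatrix) (i : Fin 3) : TwoQubitMatrix :=
  CFC.sqrt ρ * (pauli i ⊗ₖ (1 : Matrix (Fin 2) (Fin 2) ℂ)) * CFC.sqrt ρ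

/-- `T` is right-unitary: `T T† = 1`. -/
def IsRightUnitary {K : ℕ} (T : Matrix (Fin 2 × Fin 2) (Fin K) ℂ) : Prop :=
  T * Tᴴ = 1

/-- `D(ρ, T) = ∑_j (∑_i |(T† A_i T)_{jj}|²)^{1/2}`. -/
noncomputable def distT (ρ : TwoQubitMatrix) {K : ℕ}
    (T : Matrix (Fin 2 × Fin 2) (Fin K) ℂ) : ℝ :=
  ∑ j, Real.sqrt (∑ i, ‖(Tᴴ * bigA ρ i * T) j j‖ ^ 2)

/-- All values `D(ρ, T)`, for right-unitary `T` with any number of columns. -/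
def distValues (ρ : TwoQubitMatrix) : Set ℝ :=
  {x | ∃ (K : ℕ) (T : Matrix (Fin 2 × Fin 2) (Fin K) ℂ), IsRightUnitary T ∧ x = distT ρ T}

/-- `D(ρ)`, the minimal value of `D(ρ, T)` over all right-unitary `T`, written as an infimum. -/
noncomputable def dist21 (ρ : TwoQubitMatrix) : ℝ :=
  sInf (distValues ρ)

/-! A right-unitary `T` splits `ρ` into unnormalised pure states, and `D(ρ, T)` is the sum of the
lengths of their Bloch vectors for `A`. The triangle inequality bounds it below by `‖bloch pauliA
ρ‖`. For pure states both Bloch vectors have equal length (`norm_bloch_pure`), so `‖bloch pauliB ρ‖`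
is a lower bound too.

For equality write `ρ = V V†` with `V` of size 4×2. The difference of the squared Bloch lengths is a
sum of 2×2 minors, so for `V H V†` it is `det H` times its value at `H = 1`
(`norm_pullback_sq_sub`). If that value is positive, the linear map from `H = s + n·σ` to the `A`
vector of `V H V†` has a kernel element by dimension count, and it satisfies `|s| ≤ |n|`. With `|n|
= 1`, the projections `(1 ± n·σ)/2` split `ρ` into pure states whose `A` vectors are nonnegative
multiples of that of `ρ`, and the triangle inequality is sharp. If the value is negative, exchange
`A` and `B`; if it is zero, take a limit (`exists_spaceUnit`). -/

/-- The Pauli matrices acting on the first qubit. -/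
def pauliA (i : Fin 3) : TwoQubitMatrix := pauli i ⊗ₖ (1 : Matrix (Fin 2) (Fin 2) ℂ)

/-- The Pauli matrices acting on the second qubit. -/
def pauliB (i : Fin 3) : TwoQubitMatrix := (1 : Matrix (Fin 2) (Fin 2) ℂ) ⊗ₖ pauli i

/-- The real vector `(Re Tr (R Sᵢ))ᵢ`; for `S = pauliA` or `S = pauliB` and a state `R` this is
the Bloch vector of a reduced state. -/
noncomputable def bloch (S : Fin 3 → TwoQubitMatrix) :
    TwoQubitMatrix →ₗ[ℝ] EuclideanSpace ℝ (Fin 3) where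
  toFun R := WithLp.toLp 2 fun i => (R * S i).trace.re
  map_add' R R' := by ext i; simp [add_mul]
  map_smul' c R := by ext i; simp

theorem bloch_apply (S : Fin 3 → TwoQubitMatrix) (R : TwoQubitMatrix) (i : Fin 3) :
    bloch S R i = (R * S i).trace.re := rfl

theorem isHermitian_pauli (i : Fin 3) : (pauli i).IsHermitian := by
  ext a b
  fin_cases i <;> fin_cases a <;> fin_cases b <;> simp [pauli]

theorem isHermitian_pauliA (i : Fin 3) : (pauliA i).IsHermitian := by
  rw [Matrix.IsHermitian, pauliA, Matrix.conjTranspose_kronecker, isHermitian_pauli,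
    Matrix.conjTranspose_one]

theorem isHermitian_pauliB (i : Fin 3) : (pauliB i).IsHermitian := by
  rw [Matrix.IsHermitian, pauliB, Matrix.conjTranspose_kronecker, isHermitian_pauli,
    Matrix.conjTranspose_one]

theorem trace_mul_eq_ofReal {R S : TwoQubitMatrix} (hR : R.IsHermitian) (hS : S.IsHermitian) :
    (R * S).trace = ((R * S).trace.re : ℂ) := by
  have h : star (R * S).trace = (R * S).trace := by
    rw [← Matrix.trace_conjTranspose, Matrix.conjTranspose_mul, hR, hS, Matrix.trace_mul_comm]
  exact (Complex.conj_eq_iff_re.mp h).symm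

theorem norm_bloch_sq {S : Fin 3 → TwoQubitMatrix} (hS : ∀ i, (S i).IsHermitian)
    {R : TwoQubitMatrix} (hR : R.IsHermitian) :
    ((‖bloch S R‖ ^ 2 : ℝ) : ℂ) = ∑ i, (R * S i).trace ^ 2 := by
  rw [EuclideanSpace.norm_sq_eq]
  push_cast
  refine Finset.sum_congr rfl fun i _ => ?_
  rw [trace_mul_eq_ofReal hR (hS i), bloch_apply, Real.norm_eq_abs]
  norm_cast
  exact sq_abs _

theorem norm_bloch_eq_sqrt {S : Fin 3 → TwoQubitMatrix} (hS : ∀ i, (S i).IsHermitian)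
    {R : TwoQubitMatrix} (hR : R.IsHermitian) :
    ‖bloch S R‖ = Real.sqrt (∑ i, ‖(R * S i).trace‖ ^ 2) := by
  rw [EuclideanSpace.norm_eq]
  congr 1
  refine Finset.sum_congr rfl fun i _ => ?_
  rw [trace_mul_eq_ofReal hR (hS i), bloch_apply, Complex.norm_real]

/-! ### Minors and the difference of the squared Bloch lengths -/

/-- The 2×2 minor of `R` with rows `p, q` and columns `r, s`. -/
def minor {m n : Type*} (R : Matrix m n ℂ) (p q : m) (r s : n) : ℂ :=
  R p r * R q s - R p s * R q r

/-- Each sum of squares is twice the trace of the squared reduced matrix minus `(Tr R)²`. The last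
terms cancel, and the products of entries pair off into minors. -/
theorem sum_trace_pauli_sub (R : TwoQubitMatrix) :
    ∑ i, (R * pauliA i).trace ^ 2 - ∑ i, (R * pauliB i).trace ^ 2 =
      2 * ∑ i, ∑ j, ∑ k, ∑ l, minor R (i, j) (k, l) (k, j) (i, l) := by
  simp only [Matrix.trace, Matrix.diag, Matrix.mul_apply, Fintype.sum_prod_type, Fin.sum_univ_two,
    Fin.sum_univ_three, pauliA, pauliB, pauli, Matrix.kroneckerMap_apply, minor]
  simp
  ring_nf
  simp only [Complex.I_sq]
  ring

/-- Multiplicativity of the determinant: the inner dimension is 2. -/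
theorem minor_mul_mul {m n : Type*} (V : Matrix m (Fin 2) ℂ) (H : Matrix (Fin 2) (Fin 2) ℂ)
    (W : Matrix (Fin 2) n ℂ) (p q : m) (r s : n) :
    minor (V * H * W) p q r s = H.det * minor (V * W) p q r s := by
  simp only [minor, Matrix.mul_apply, Fin.sum_univ_two, Matrix.det_fin_two]
  ring

theorem sum_trace_pauli_sub_mul_mul (V : Matrix (Fin 2 × Fin 2) (Fin 2) ℂ)
    (H : Matrix (Fin 2) (Fin 2) ℂ) (W : Matrix (Fin 2) (Fin 2 × Fin 2) ℂ) :
    ∑ i, (V * H * W * pauliA i).trace ^ 2 - ∑ i, (V * H * W * pauliB i).trace ^ 2 =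
      H.det * (∑ i, (V * W * pauliA i).trace ^ 2 - ∑ i, (V * W * pauliB i).trace ^ 2) := by
  simp only [sum_trace_pauli_sub, minor_mul_mul, ← Finset.mul_sum]
  ring

theorem isHermitian_vecMulVec_star {n : Type*} (ψ : n → ℂ) :
    (Matrix.vecMulVec ψ (star ψ)).IsHermitian := by
  ext a b
  simp [Matrix.vecMulVec_apply, mul_comm]

/-- All 2×2 minors of a rank-one matrix vanish. -/
theorem norm_bloch_pure (ψ : Fin 2 × Fin 2 → ℂ) :
    ‖bloch pauliA (Matrix.vecMulVec ψ (star ψ))‖ = ‖bloch pauliB (Matrix.vecMulVec ψ (star ψ))‖ := by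
  rw [← sq_eq_sq₀ (norm_nonneg _) (norm_nonneg _), ← Complex.ofReal_inj,
    norm_bloch_sq isHermitian_pauliA (isHermitian_vecMulVec_star ψ),
    norm_bloch_sq isHermitian_pauliB (isHermitian_vecMulVec_star ψ), ← sub_eq_zero,
    sum_trace_pauli_sub]
  have h : ∀ p q r s, minor (Matrix.vecMulVec ψ (star ψ)) p q r s = 0 := fun p q r s => by
    simp only [minor, Matrix.vecMulVec_apply]
    ring
  simp [h]

theorem trace_vecMulVec_mul {n : Type*} [Fintype n] (ψ φ : n → ℂ) (S : Matrix n n ℂ) :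
    (Matrix.vecMulVec ψ φ * S).trace = φ ⬝ᵥ S *ᵥ ψ := by
  rw [Matrix.vecMulVec_mul, Matrix.trace_vecMulVec, dotProduct_comm, Matrix.dotProduct_mulVec]

/-! ### Pure-state ensembles and the lower bound -/

/-- The unnormalised pure state `√ρ |t_j⟩⟨t_j| √ρ` for the `j`-th column `t_j` of `T`. -/
noncomputable def ensemble (ρ : TwoQubitMatrix) {κ : Type*} (T : Matrix (Fin 2 × Fin 2) κ ℂ)
    (j : κ) : TwoQubitMatrix :=
  Matrix.vecMulVec ((CFC.sqrt ρ * T).col j) (star ((CFC.sqrt ρ * T).col j))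

theorem isHermitian_sqrt (ρ : TwoQubitMatrix) : (CFC.sqrt ρ).IsHermitian :=
  (Matrix.nonneg_iff_posSemidef.mp (CFC.sqrt_nonneg ρ)).isHermitian

theorem conj_bigA_apply (ρ : TwoQubitMatrix) {κ : Type*} (T : Matrix (Fin 2 × Fin 2) κ ℂ)
    (i : Fin 3) (j : κ) :
    (Tᴴ * bigA ρ i * T) j j = (ensemble ρ T j * pauliA i).trace := by
  rw [ensemble, trace_vecMulVec_mul]
  have h : Tᴴ * bigA ρ i * T = (CFC.sqrt ρ * T)ᴴ * (pauliA i * (CFC.sqrt ρ * T)) := by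
    rw [Matrix.conjTranspose_mul, isHermitian_sqrt]
    simp only [bigA, pauliA, Matrix.mul_assoc]
  rw [h, Matrix.mul_apply']
  rfl

theorem isHermitian_ensemble (ρ : TwoQubitMatrix) {κ : Type*} (T : Matrix (Fin 2 × Fin 2) κ ℂ)
    (j : κ) : (ensemble ρ T j).IsHermitian := isHermitian_vecMulVec_star _

theorem distT_eq (ρ : TwoQubitMatrix) {K : ℕ} (T : Matrix (Fin 2 × Fin 2) (Fin K) ℂ) :
    distT ρ T = ∑ j, ‖bloch pauliA (ensemble ρ T j)‖ := by
  simp only [distT, conj_bigA_apply,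
    norm_bloch_eq_sqrt isHermitian_pauliA (isHermitian_ensemble ρ T _)]

theorem sum_ensemble {ρ : TwoQubitMatrix} (hρ : ρ.PosSemidef) {κ : Type*} [Fintype κ]
    {T : Matrix (Fin 2 × Fin 2) κ ℂ} (hT : T * Tᴴ = 1) : ∑ j, ensemble ρ T j = ρ := by
  have h : ∑ j, ensemble ρ T j = (CFC.sqrt ρ * T) * (CFC.sqrt ρ * T)ᴴ := by
    ext a b
    rw [Matrix.sum_apply, Matrix.mul_apply]
    rfl
  rw [h, Matrix.conjTranspose_mul, isHermitian_sqrt, Matrix.mul_assoc, ← Matrix.mul_assoc T, hT,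
    Matrix.one_mul]
  exact CFC.sqrt_mul_sqrt_self ρ (Matrix.nonneg_iff_posSemidef.mpr hρ)

theorem max_norm_bloch_le_distT {ρ : TwoQubitMatrix} (hρ : ρ.PosSemidef) {K : ℕ}
    {T : Matrix (Fin 2 × Fin 2) (Fin K) ℂ} (hT : IsRightUnitary T) :
    max ‖bloch pauliA ρ‖ ‖bloch pauliB ρ‖ ≤ distT ρ T := by
  rw [distT_eq]
  refine max_le ?_ ?_
  · conv_lhs => rw [← sum_ensemble hρ hT, map_sum]
    exact norm_sum_le _ _
  · conv_lhs => rw [← sum_ensemble hρ hT, map_sum]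
    refine (norm_sum_le _ _).trans_eq (Finset.sum_congr rfl fun j _ => ?_)
    exact (norm_bloch_pure _).symm

/-! ### Hilbert-Schmidt distances as Bloch lengths -/

theorem hsNorm_eq {X : Matrix (Fin 2) (Fin 2) ℂ} {r : ℝ} (hr : 0 ≤ r)
    (h : 2 * (Xᴴ * X).trace = ((r ^ 2 : ℝ) : ℂ)) : Real.sqrt 2 * hsNorm X = r := by
  have h' := congrArg Complex.re h
  rw [Complex.ofReal_re, Complex.mul_re, Complex.re_ofNat, Complex.im_ofNat, zero_mul,
    sub_zero] at h'
  rw [hsNorm, ← Real.sqrt_mul zero_le_two, h', Real.sqrt_sq hr]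

theorem isHermitian_traceA {ρ : TwoQubitMatrix} (hρ : ρ.IsHermitian) :
    (traceA ρ).IsHermitian := by
  ext i k
  simp only [traceA, Matrix.conjTranspose_apply, Matrix.of_apply, star_sum, hρ.apply]

theorem isHermitian_traceB {ρ : TwoQubitMatrix} (hρ : ρ.IsHermitian) :
    (traceB ρ).IsHermitian := by
  ext i k
  simp only [traceB, Matrix.conjTranspose_apply, Matrix.of_apply, star_sum, hρ.apply]

theorem hsNorm_traceB {ρ : TwoQubitMatrix} (hρ : ρ.IsHermitian) (htr : ρ.trace = 1) :
    Real.sqrt 2 * hsNorm (traceB ρ - (1 / 2 : ℂ) • (1 : Matrix (Fin 2) (Fin 2) ℂ)) =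
      ‖bloch pauliA ρ‖ := by
  refine hsNorm_eq (norm_nonneg _) ?_
  rw [norm_bloch_sq isHermitian_pauliA hρ]
  -- A polynomial identity in the entries of any `ρ`; the last term disappears when the trace is 1.
  have key : 2 * ((traceB ρ - (1 / 2 : ℂ) • 1) * (traceB ρ - (1 / 2 : ℂ) • 1)).trace =
      ∑ i, (ρ * pauliA i).trace ^ 2 + (ρ.trace - 1) ^ 2 := by
    simp only [Matrix.trace, Matrix.diag, Matrix.mul_apply, Fintype.sum_prod_type,
      Fin.sum_univ_two, Fin.sum_univ_three, pauliA, pauli, Matrix.kroneckerMap_apply, traceB]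
    simp
    ring_nf
    simp only [Complex.I_sq]
    ring
  rw [htr] at key
  simpa [isHermitian_traceB hρ |>.eq] using key

theorem hsNorm_traceA {ρ : TwoQubitMatrix} (hρ : ρ.IsHermitian) (htr : ρ.trace = 1) :
    Real.sqrt 2 * hsNorm (traceA ρ - (1 / 2 : ℂ) • (1 : Matrix (Fin 2) (Fin 2) ℂ)) =
      ‖bloch pauliB ρ‖ := by
  refine hsNorm_eq (norm_nonneg _) ?_
  rw [norm_bloch_sq isHermitian_pauliB hρ]
  have key : 2 * ((traceA ρ - (1 / 2 : ℂ) • 1) * (traceA ρ - (1 / 2 : ℂ) • 1)).trace =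
      ∑ i, (ρ * pauliB i).trace ^ 2 + (ρ.trace - 1) ^ 2 := by
    simp only [Matrix.trace, Matrix.diag, Matrix.mul_apply, Fintype.sum_prod_type,
      Fin.sum_univ_two, Fin.sum_univ_three, pauliB, pauli, Matrix.kroneckerMap_apply, traceA]
    simp
    ring_nf
    simp only [Complex.I_sq]
    ring
  rw [htr] at key
  simpa [isHermitian_traceA hρ |>.eq] using key

/-! ### The Lorentz form on Hermitian 2×2 matrices and a kernel vector -/

/-- The Hermitian 2×2 matrix `h₀ 1 + h₁ σ_x + h₂ σ_y + h₃ σ_z`. -/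
noncomputable def hermOf : (Fin 4 → ℝ) →ₗ[ℝ] Matrix (Fin 2) (Fin 2) ℂ where
  toFun h := !![(h 0 + h 3 : ℂ), h 1 - Complex.I * h 2; h 1 + Complex.I * h 2, h 0 - h 3]
  map_add' h k := by
    ext a b
    fin_cases a <;> fin_cases b <;> simp <;> ring
  map_smul' c h := by
    ext a b
    fin_cases a <;> fin_cases b <;> simp <;> ring

theorem hermOf_apply (h : Fin 4 → ℝ) :
    hermOf h = !![(h 0 + h 3 : ℂ), h 1 - Complex.I * h 2; h 1 + Complex.I * h 2, h 0 - h 3] := rfl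

theorem isHermitian_hermOf (h : Fin 4 → ℝ) : (hermOf h).IsHermitian := by
  ext a b
  fin_cases a <;> fin_cases b <;> simp [hermOf_apply]
  ring

theorem det_hermOf (h : Fin 4 → ℝ) :
    (hermOf h).det = ((h 0 ^ 2 - (h 1 ^ 2 + h 2 ^ 2 + h 3 ^ 2) : ℝ) : ℂ) := by
  rw [hermOf_apply, Matrix.det_fin_two_of]
  push_cast
  linear_combination (h 2 : ℂ) ^ 2 * Complex.I_sq

/-- The map `h ↦ bloch S (V H(h) V†)` on the coordinates `h` of a Hermitian matrix. -/
noncomputable def pullback (S : Fin 3 → TwoQubitMatrix) (V : Matrix (Fin 2 × Fin 2) (Fin 2) ℂ) :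
    (Fin 4 → ℝ) →ₗ[ℝ] EuclideanSpace ℝ (Fin 3) where
  toFun h := bloch S (V * hermOf h * Vᴴ)
  map_add' h k := by simp [Matrix.mul_add, Matrix.add_mul]
  map_smul' c h := by simp

theorem pullback_apply (S : Fin 3 → TwoQubitMatrix) (V : Matrix (Fin 2 × Fin 2) (Fin 2) ℂ)
    (h : Fin 4 → ℝ) : pullback S V h = bloch S (V * hermOf h * Vᴴ) := rfl

/-- The difference of the squared lengths of the two Bloch vectors of `V V†`. -/
noncomputable def blochGap (V : Matrix (Fin 2 × Fin 2) (Fin 2) ℂ) : ℝ :=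
  ‖bloch pauliA (V * Vᴴ)‖ ^ 2 - ‖bloch pauliB (V * Vᴴ)‖ ^ 2

theorem norm_pullback_sq_sub (V : Matrix (Fin 2 × Fin 2) (Fin 2) ℂ) (h : Fin 4 → ℝ) :
    ‖pullback pauliA V h‖ ^ 2 - ‖pullback pauliB V h‖ ^ 2 =
      (h 0 ^ 2 - (h 1 ^ 2 + h 2 ^ 2 + h 3 ^ 2)) * blochGap V := by
  have hV := Matrix.isHermitian_mul_conjTranspose_self V
  have hH := Matrix.isHermitian_mul_mul_conjTranspose V (isHermitian_hermOf h)
  rw [← Complex.ofReal_inj, Complex.ofReal_mul, Complex.ofReal_sub, ← det_hermOf, blochGap,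
    Complex.ofReal_sub, pullback_apply, pullback_apply, norm_bloch_sq isHermitian_pauliA hH,
    norm_bloch_sq isHermitian_pauliB hH, norm_bloch_sq isHermitian_pauliA hV,
    norm_bloch_sq isHermitian_pauliB hV, sum_trace_pauli_sub_mul_mul]

/-- Coordinates `(s, n)` with `|n| = 1` and `|s| ≤ 1`. -/
def spaceUnit : Set (Fin 4 → ℝ) :=
  {h | h 0 ^ 2 ≤ 1 ∧ h 1 ^ 2 + h 2 ^ 2 + h 3 ^ 2 = 1}

theorem isCompact_spaceUnit : IsCompact spaceUnit := by
  refine (isCompact_univ_pi fun _ : Fin 4 => isCompact_Icc (a := (-1 : ℝ)) (b := 1)).of_isClosed_subset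
    ?_ ?_
  · have h0 : Continuous fun h : Fin 4 → ℝ => h 0 ^ 2 := by fun_prop
    have h1 : Continuous fun h : Fin 4 → ℝ => h 1 ^ 2 + h 2 ^ 2 + h 3 ^ 2 := by fun_prop
    exact (isClosed_le h0 continuous_const).inter (isClosed_eq h1 continuous_const)
  · rintro h ⟨h0, h1⟩ i -
    rw [Set.mem_Icc, ← abs_le, ← sq_le_one_iff_abs_le_one]
    have h2 := sq_nonneg (h 1)
    have h3 := sq_nonneg (h 2)
    have h4 := sq_nonneg (h 3)
    match i with
    | 0 => exact h0
    | 1 => linarith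
    | 2 => linarith
    | 3 => linarith

/-- A kernel element of `L` exists because 4 > 3. On it the identity reads `-‖M h‖² = (h₀² - |n|²)
c`, which forces `h₀² ≤ |n|²`; then rescale to `|n| = 1`. Keeping `L` and `M` abstract lets the two
qubits exchange roles. -/
theorem exists_spaceUnit_of_norm {L M : (Fin 4 → ℝ) →ₗ[ℝ] EuclideanSpace ℝ (Fin 3)} {c : ℝ}
    (hc : 0 < c)
    (hLM : ∀ h, ‖L h‖ ^ 2 - ‖M h‖ ^ 2 = (h 0 ^ 2 - (h 1 ^ 2 + h 2 ^ 2 + h 3 ^ 2)) * c) :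
    ∃ h ∈ spaceUnit, L h = 0 := by
  obtain ⟨h, hker, h0⟩ := Submodule.exists_mem_ne_zero_of_ne_bot
    (LinearMap.ker_ne_bot_of_finrank_lt (f := L) (by simp))
  rw [LinearMap.mem_ker] at hker
  have hle : h 0 ^ 2 ≤ h 1 ^ 2 + h 2 ^ 2 + h 3 ^ 2 := by
    have := hLM h
    rw [hker, norm_zero] at this
    by_contra! hlt
    nlinarith [mul_pos (sub_pos.mpr hlt) hc, sq_nonneg ‖M h‖]
  set r := h 1 ^ 2 + h 2 ^ 2 + h 3 ^ 2 with hr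
  have hpos : 0 < r := by
    by_contra! hr0
    refine h0 (funext fun i => ?_)
    have h1 := sq_nonneg (h 1)
    have h2 := sq_nonneg (h 2)
    have h3 := sq_nonneg (h 3)
    have : h i ^ 2 ≤ 0 := by
      match i with
      | 0 => linarith
      | 1 => linarith
      | 2 => linarith
      | 3 => linarith
    exact pow_eq_zero_iff two_ne_zero |>.mp (le_antisymm this (sq_nonneg _))
  have hs : (Real.sqrt r)⁻¹ ^ 2 = r⁻¹ := by rw [inv_pow, Real.sq_sqrt hpos.le]
  refine ⟨(Real.sqrt r)⁻¹ • h, ⟨?_, ?_⟩, by rw [map_smul, hker, smul_zero]⟩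
  · simp only [Pi.smul_apply, smul_eq_mul, mul_pow, hs]
    rw [inv_mul_le_iff₀ hpos, mul_one]
    exact hle
  · simp only [Pi.smul_apply, smul_eq_mul, mul_pow, hs, ← mul_add]
    rw [← hr, inv_mul_cancel₀ hpos.ne']

theorem exists_spaceUnit_of_pos {V : Matrix (Fin 2 × Fin 2) (Fin 2) ℂ} (hV : 0 < blochGap V) :
    ∃ h ∈ spaceUnit, pullback pauliA V h = 0 :=
  exists_spaceUnit_of_norm hV (norm_pullback_sq_sub V)

theorem exists_spaceUnit_of_neg {V : Matrix (Fin 2 × Fin 2) (Fin 2) ℂ} (hV : blochGap V < 0) :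
    ∃ h ∈ spaceUnit, pullback pauliB V h = 0 :=
  exists_spaceUnit_of_norm (M := pullback pauliA V) (neg_pos.mpr hV) fun h => by
    linarith [norm_pullback_sq_sub V h]

/-! ### The degenerate case by density and compactness -/

theorem continuous_bloch (S : Fin 3 → TwoQubitMatrix) : Continuous (bloch S) :=
  (PiLp.continuous_toLp 2 _).comp (by fun_prop)

theorem continuous_hermOf : Continuous hermOf :=
  hermOf.continuous_of_finiteDimensional

theorem continuous_blochGap : Continuous blochGap := by
  have := continuous_bloch
  unfold blochGap
  fun_prop

/-- Projection along the compact set `spaceUnit` is a closed map. -/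
theorem isClosed_exists_spaceUnit (S : Fin 3 → TwoQubitMatrix) :
    IsClosed {V | ∃ h ∈ spaceUnit, pullback S V h = 0} := by
  have : CompactSpace spaceUnit := isCompact_iff_compactSpace.mp isCompact_spaceUnit
  have hcl : IsClosed {p : spaceUnit × Matrix (Fin 2 × Fin 2) (Fin 2) ℂ |
      pullback S p.2 p.1 = 0} := by
    have := continuous_bloch
    have := continuous_hermOf
    simp only [pullback_apply]
    exact isClosed_eq (by fun_prop) continuous_const
  convert isClosedMap_snd_of_compactSpace _ hcl using 1
  ext V
  simp

theorem bloch_add_smul (S : Fin 3 → TwoQubitMatrix) (V U : Matrix (Fin 2 × Fin 2) (Fin 2) ℂ)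
    (ε : ℝ) : bloch S ((V + ε • U) * (V + ε • U)ᴴ) =
      bloch S (V * Vᴴ) + ε • bloch S (V * Uᴴ + U * Vᴴ) + ε ^ 2 • bloch S (U * Uᴴ) := by
  rw [← map_smul, ← map_smul, ← map_add, ← map_add]
  congr 1
  simp only [Matrix.conjTranspose_add, Matrix.conjTranspose_smul, star_trivial, Matrix.add_mul,
    Matrix.mul_add, Matrix.smul_mul, Matrix.mul_smul, smul_add, smul_smul, pow_two]
  abel

theorem exists_polynomial_norm_bloch (S : Fin 3 → TwoQubitMatrix)
    (V U : Matrix (Fin 2 × Fin 2) (Fin 2) ℂ) :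
    ∃ p : Polynomial ℝ, ∀ ε : ℝ,
      ‖bloch S ((V + ε • U) * (V + ε • U)ᴴ)‖ ^ 2 = p.eval ε := by
  refine ⟨∑ i, (.C (bloch S (V * Vᴴ) i) + .X * .C (bloch S (V * Uᴴ + U * Vᴴ) i) +
    .X ^ 2 * .C (bloch S (U * Uᴴ) i)) ^ 2, fun ε => ?_⟩
  rw [bloch_add_smul, EuclideanSpace.norm_sq_eq, Polynomial.eval_finsetSum]
  refine Finset.sum_congr rfl fun i _ => ?_
  simp only [Real.norm_eq_abs, sq_abs, PiLp.add_apply, PiLp.smul_apply, smul_eq_mul,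
    Polynomial.eval_pow, Polynomial.eval_add, Polynomial.eval_mul, Polynomial.eval_C,
    Polynomial.eval_X]

theorem exists_blochGap_ne_zero : ∃ W, blochGap W ≠ 0 := by
  -- Here `W W† = |0⟩⟨0| ⊗ 1`, with Bloch vectors of lengths 2 and 0.
  refine ⟨Matrix.of fun i j => if i = (0, j) then 1 else 0, ?_⟩
  simp [blochGap, EuclideanSpace.norm_sq_eq, bloch_apply, Matrix.trace, Matrix.mul_apply,
    Fintype.sum_prod_type, Fin.sum_univ_two, Fin.sum_univ_three, pauliA, pauliB, pauli]

/-- On the line from `V` to a point `W` with nonzero gap, the gap is a nonzero polynomial, so its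
zeros are finitely many and `V` is a limit of non-zeros. -/
theorem dense_blochGap_ne_zero : Dense {V | blochGap V ≠ 0} := by
  intro V
  obtain ⟨W, hW⟩ := exists_blochGap_ne_zero
  obtain ⟨p, hp⟩ := exists_polynomial_norm_bloch pauliA V (W - V)
  obtain ⟨q, hq⟩ := exists_polynomial_norm_bloch pauliB V (W - V)
  have hgap : ∀ ε : ℝ, blochGap (V + ε • (W - V)) = (p - q).eval ε := fun ε => by
    rw [blochGap, hp, hq, Polynomial.eval_sub]
  have hne : p - q ≠ 0 := fun h => hW <| by simpa [h] using hgap 1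
  have hd : Dense {ε : ℝ | (p - q).eval ε ≠ 0} := by
    refine ((p - q).roots.toFinset.finite_toSet.countable.dense_compl ℝ).mono fun ε hε => ?_
    simpa [hne, sub_eq_zero] using hε
  have hc : Continuous fun ε : ℝ => V + ε • (W - V) := by fun_prop
  have := map_mem_closure hc (hd 0) (t := {V | blochGap V ≠ 0}) fun ε hε => by
    simpa only [Set.mem_ofPred_eq, hgap] using hε
  simpa using this

/-- The non-strict inequalities make each alternative closed in `V`, so it is enough to treat the
dense set of nonzero gap. -/
theorem exists_spaceUnit (V : Matrix (Fin 2 × Fin 2) (Fin 2) ℂ) :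
    (0 ≤ blochGap V ∧ ∃ h ∈ spaceUnit, pullback pauliA V h = 0) ∨
      (blochGap V ≤ 0 ∧ ∃ h ∈ spaceUnit, pullback pauliB V h = 0) := by
  have hcl : IsClosed {V | (0 ≤ blochGap V ∧ ∃ h ∈ spaceUnit, pullback pauliA V h = 0) ∨
      (blochGap V ≤ 0 ∧ ∃ h ∈ spaceUnit, pullback pauliB V h = 0)} :=
    ((isClosed_le continuous_const continuous_blochGap).inter
      (isClosed_exists_spaceUnit pauliA)).union
    ((isClosed_le continuous_blochGap continuous_const).inter
      (isClosed_exists_spaceUnit pauliB))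
  refine hcl.closure_subset_iff.mpr ?_ (dense_blochGap_ne_zero V)
  intro W hW
  rcases lt_or_gt_of_ne hW with h | h
  · exact Or.inr ⟨h.le, exists_spaceUnit_of_neg h⟩
  · exact Or.inl ⟨h.le, exists_spaceUnit_of_pos h⟩

/-! ### Optimal decompositions and the upper bound -/

theorem mul_conjTranspose_eq_sum_vecMulVec {m κ : Type*} [Fintype κ] (T : Matrix m κ ℂ) :
    T * Tᴴ = ∑ j, Matrix.vecMulVec (T.col j) (star (T.col j)) := by
  ext a b
  rw [Matrix.sum_apply, Matrix.mul_apply]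
  rfl

theorem exists_unitary_col_of_unit {x y z : ℝ} (h : x ^ 2 + y ^ 2 + z ^ 2 = 1) :
    ∃ t : Matrix (Fin 2) (Fin 2) ℂ, t * tᴴ = 1 ∧
      Matrix.vecMulVec (t.col 0) (star (t.col 0)) = (1 / 2 : ℝ) • hermOf ![1, x, y, z] := by
  -- The vector `(1 + z, x + iy)` spans the range of `1 + n·σ` except at the south pole, where it
  -- vanishes. Its norm is the `c` below.
  rcases eq_or_ne (1 + z) 0 with hz | hz
  · obtain rfl : z = -1 := by linarith
    obtain rfl : x = 0 := by nlinarith [sq_nonneg x, sq_nonneg y]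
    obtain rfl : y = 0 := by nlinarith [sq_nonneg y]
    refine ⟨!![0, 1; 1, 0], ?_, ?_⟩
    · ext a b
      fin_cases a <;> fin_cases b <;> simp [Matrix.mul_apply]
    · ext a b
      fin_cases a <;> fin_cases b <;> simp [Matrix.vecMulVec_apply, hermOf_apply]
      norm_num
  · have hpos : 0 < 1 + z := lt_of_le_of_ne (by nlinarith [sq_nonneg x, sq_nonneg y]) hz.symm
    set c := Real.sqrt (2 * (1 + z))
    have hc2 : (c : ℂ) ^ 2 = 2 * (1 + z) := by
      exact_mod_cast Real.sq_sqrt (by positivity : 0 ≤ 2 * (1 + z))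
    have hc0 : (c : ℂ) ≠ 0 := by
      exact_mod_cast (Real.sqrt_pos.mpr (by positivity : 0 < 2 * (1 + z))).ne'
    have hn : (x : ℂ) ^ 2 + y ^ 2 + z ^ 2 = 1 := by exact_mod_cast h
    have hI := Complex.I_sq
    refine ⟨!![(1 + z) / c, -(x - Complex.I * y) / c; (x + Complex.I * y) / c, (1 + z) / c],
      ?_, ?_⟩
    · ext a b
      fin_cases a <;> fin_cases b <;> simp [Matrix.mul_apply] <;> field_simp <;> rw [hc2]
      · linear_combination hn - (y : ℂ) ^ 2 * hI
      · ring
      · ring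
      · linear_combination hn - (y : ℂ) ^ 2 * hI
    · ext a b
      fin_cases a <;> fin_cases b <;> simp [Matrix.vecMulVec_apply, hermOf_apply] <;>
        field_simp <;> rw [hc2]
      · ring
      · ring
      · ring
      · linear_combination 2 * hn - 2 * (y : ℂ) ^ 2 * hI

theorem sqrt_mulVec_eq_zero {ρ : TwoQubitMatrix} (hρ : ρ.PosSemidef) {v : Fin 2 × Fin 2 → ℂ}
    (hv : ρ *ᵥ v = 0) : CFC.sqrt ρ *ᵥ v = 0 := by
  rw [← Matrix.conjTranspose_mul_self_mulVec_eq_zero, isHermitian_sqrt,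
    CFC.sqrt_mul_sqrt_self ρ (Matrix.nonneg_iff_posSemidef.mpr hρ), hv]

theorem exists_unitary_of_rank_eq_two {ρ : TwoQubitMatrix} (hρ : ρ.PosSemidef)
    (hrank : ρ.rank = 2) : ∃ W : Matrix (Fin 2 × Fin 2) (Fin 2 ⊕ Fin 2) ℂ, W * Wᴴ = 1 ∧
      ∀ k, CFC.sqrt ρ *ᵥ W.col (Sum.inr k) = 0 := by
  have hH := hρ.isHermitian
  have h1 : Fintype.card {i // hH.eigenvalues i ≠ 0} = 2 := by
    rw [← hH.rank_eq_card_non_zero_eigs, hrank]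
  have h2 : Fintype.card {i // ¬ hH.eigenvalues i ≠ 0} = 2 := by
    rw [Fintype.card_subtype_compl, h1]
    rfl
  -- Orders the eigenbasis so that the `inr` columns span the kernel of `ρ`.
  let e : Fin 2 ⊕ Fin 2 ≃ Fin 2 × Fin 2 :=
    (Equiv.sumCongr (Fintype.equivFinOfCardEq h1).symm (Fintype.equivFinOfCardEq h2).symm).trans
      (Equiv.sumCompl _)
  have he : ∀ k, hH.eigenvalues (e (Sum.inr k)) = 0 := fun k =>
    not_not.mp ((Fintype.equivFinOfCardEq h2).symm k).2
  refine ⟨(hH.eigenvectorUnitary : TwoQubitMatrix).submatrix id e, ?_, fun k => ?_⟩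
  · rw [Matrix.conjTranspose_submatrix, Matrix.submatrix_mul_equiv, ← Matrix.star_eq_conjTranspose,
      Unitary.mul_star_self_of_mem hH.eigenvectorUnitary.2, Matrix.submatrix_id_id]
  · refine sqrt_mulVec_eq_zero hρ ?_
    have := hH.mulVec_eigenvectorBasis (e (Sum.inr k))
    rwa [he, zero_smul] at this

theorem sum_norm_bloch_mem_distValues (ρ : TwoQubitMatrix) {κ : Type*} [Fintype κ]
    {T : Matrix (Fin 2 × Fin 2) κ ℂ} (hT : T * Tᴴ = 1) :
    ∑ j, ‖bloch pauliA (ensemble ρ T j)‖ ∈ distValues ρ := by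
  refine ⟨Fintype.card κ, T.submatrix id (Fintype.equivFin κ).symm, ?_, ?_⟩
  · rw [IsRightUnitary, Matrix.conjTranspose_submatrix, Matrix.submatrix_mul_equiv, hT,
      Matrix.submatrix_id_id]
  · rw [distT_eq, ← (Fintype.equivFin κ).symm.sum_comp]
    rfl

theorem vecMulVec_mulVec_star {m n : Type*} [Fintype n] (V : Matrix m n ℂ) (t : n → ℂ) :
    Matrix.vecMulVec (V *ᵥ t) (star (V *ᵥ t)) = V * Matrix.vecMulVec t (star t) * Vᴴ := by
  rw [Matrix.star_mulVec, Matrix.mul_vecMulVec, Matrix.vecMulVec_mul]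

/-- A rank two state is `V V†`, and every decomposition of the identity on `ℂ²` into two orthogonal
projections gives a value of `D(ρ, T)`. -/
theorem exists_factor_distValues {ρ : TwoQubitMatrix} (hρ : ρ.PosSemidef) (hrank : ρ.rank = 2) :
    ∃ V : Matrix (Fin 2 × Fin 2) (Fin 2) ℂ, V * Vᴴ = ρ ∧
      ∀ t : Matrix (Fin 2) (Fin 2) ℂ, t * tᴴ = 1 →
        ∑ k, ‖bloch pauliA (Matrix.vecMulVec (V *ᵥ t.col k) (star (V *ᵥ t.col k)))‖ ∈
          distValues ρ := by
  obtain ⟨W, hW, hW0⟩ := exists_unitary_of_rank_eq_two hρ hrank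
  let V : Matrix (Fin 2 × Fin 2) (Fin 2) ℂ := CFC.sqrt ρ * W.submatrix id Sum.inl
  refine ⟨V, ?_, fun t ht => ?_⟩
  · have h := sum_ensemble hρ hW
    have h0 : ∀ k, ensemble ρ W (Sum.inr k) = 0 := fun k => by
      have : (CFC.sqrt ρ * W).col (Sum.inr k) = 0 := hW0 k
      rw [ensemble, this, star_zero, Matrix.vecMulVec_zero]
    rw [Fintype.sum_sum_type] at h
    simp only [h0, Finset.sum_const_zero, add_zero] at h
    rw [mul_conjTranspose_eq_sum_vecMulVec, ← h]
    rfl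
  -- Rotating only the support columns keeps the kernel columns, which contribute nothing.
  · let T := W * Matrix.fromBlocks t 0 0 (1 : Matrix (Fin 2) (Fin 2) ℂ)
    have hT : T * Tᴴ = 1 := by
      rw [Matrix.conjTranspose_mul, Matrix.mul_assoc, ← Matrix.mul_assoc _ _ Wᴴ,
        Matrix.fromBlocks_conjTranspose, Matrix.fromBlocks_multiply]
      simp [ht, hW]
    have h := sum_norm_bloch_mem_distValues ρ hT
    have h0 : ∀ k, ensemble ρ T (Sum.inr k) = 0 := fun k => by
      have : (CFC.sqrt ρ * T).col (Sum.inr k) = 0 := by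
        rw [← hW0 k]
        have hTW : T.col (Sum.inr k) = W.col (Sum.inr k) := by
          ext a
          simp [T, Matrix.mul_apply, Matrix.one_apply]
        rw [← hTW]
        rfl
      rw [ensemble, this, star_zero, Matrix.vecMulVec_zero]
    have h1 : ∀ k, ensemble ρ T (Sum.inl k) =
        Matrix.vecMulVec (V *ᵥ t.col k) (star (V *ᵥ t.col k)) := fun k => by
      have : (CFC.sqrt ρ * T).col (Sum.inl k) = V *ᵥ t.col k := by
        rw [← Matrix.mulVec_mulVec]
        have hTW : T.col (Sum.inl k) = W.submatrix id Sum.inl *ᵥ t.col k := by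
          ext a
          simp [T, Matrix.mul_apply, Matrix.mulVec, dotProduct]
        rw [← hTW]
        rfl
      rw [ensemble, this]
    rw [Fintype.sum_sum_type] at h
    simpa only [h0, h1, map_zero, norm_zero, Finset.sum_const_zero, add_zero] using h

theorem hermOf_single : hermOf (Pi.single 0 1) = 1 := by
  ext a b
  fin_cases a <;> fin_cases b <;> simp [hermOf_apply]

/-- Since `h = (s, n)` is in the kernel, `n·σ` maps to `-s` times the image of 1. The two
projections thus map to `(1 ∓ s)/2` times `bloch S (V * Vᴴ)`, with nonnegative coefficients summing
to 1. -/
theorem exists_unitary_sum_norm_bloch (S : Fin 3 → TwoQubitMatrix)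
    {V : Matrix (Fin 2 × Fin 2) (Fin 2) ℂ} {h : Fin 4 → ℝ} (hh : h ∈ spaceUnit)
    (h0 : pullback S V h = 0) : ∃ t : Matrix (Fin 2) (Fin 2) ℂ, t * tᴴ = 1 ∧
      ∑ k, ‖bloch S (Matrix.vecMulVec (V *ᵥ t.col k) (star (V *ᵥ t.col k)))‖ =
        ‖bloch S (V * Vᴴ)‖ := by
  obtain ⟨t, ht, ht0⟩ := exists_unitary_col_of_unit hh.2
  refine ⟨t, ht, ?_⟩
  have hs := abs_le.mp (abs_le_one_iff_mul_self_le_one.mpr (by simpa [pow_two] using hh.1))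
  have ht1 : Matrix.vecMulVec (t.col 1) (star (t.col 1)) =
      1 - Matrix.vecMulVec (t.col 0) (star (t.col 0)) := by
    rw [← ht, mul_conjTranspose_eq_sum_vecMulVec, Fin.sum_univ_two, add_sub_cancel_left]
  have h1 : pullback S V (Pi.single 0 1) = bloch S (V * Vᴴ) := by
    rw [pullback_apply, hermOf_single, Matrix.mul_one]
  have hv : ![1, h 1, h 2, h 3] = h + (1 - h 0) • Pi.single 0 1 := by
    ext i
    fin_cases i <;> simp
  have hb0 : bloch S (Matrix.vecMulVec (V *ᵥ t.col 0) (star (V *ᵥ t.col 0))) =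
      ((1 - h 0) / 2) • bloch S (V * Vᴴ) := by
    rw [vecMulVec_mulVec_star, ht0, ← map_smul, ← pullback_apply, hv, map_smul, map_add, map_smul,
      h0, h1, zero_add, smul_smul]
    congr 1
    ring
  have hb1 : bloch S (Matrix.vecMulVec (V *ᵥ t.col 1) (star (V *ᵥ t.col 1))) =
      ((1 + h 0) / 2) • bloch S (V * Vᴴ) := by
    rw [vecMulVec_mulVec_star, ht1, Matrix.mul_sub, Matrix.sub_mul, map_sub,
      ← vecMulVec_mulVec_star, hb0, Matrix.mul_one]
    module
  rw [Fin.sum_univ_two, hb0, hb1, norm_smul, norm_smul, Real.norm_of_nonneg (by linarith),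
    Real.norm_of_nonneg (by linarith)]
  ring

theorem max_norm_bloch_mem_distValues {ρ : TwoQubitMatrix} (hρ : ρ.PosSemidef)
    (hrank : ρ.rank = 2) : max ‖bloch pauliA ρ‖ ‖bloch pauliB ρ‖ ∈ distValues ρ := by
  obtain ⟨V, hV, hmem⟩ := exists_factor_distValues hρ hrank
  rcases exists_spaceUnit V with ⟨hgap, h, hh, h0⟩ | ⟨hgap, h, hh, h0⟩
  · obtain ⟨t, ht, hsum⟩ := exists_unitary_sum_norm_bloch pauliA hh h0
    have := hmem t ht
    rw [blochGap, sub_nonneg, sq_le_sq₀ (norm_nonneg _) (norm_nonneg _), hV] at hgap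
    rwa [hsum, hV, ← max_eq_left hgap] at this
  · obtain ⟨t, ht, hsum⟩ := exists_unitary_sum_norm_bloch pauliB hh h0
    have := hmem t ht
    rw [blochGap, sub_nonpos, sq_le_sq₀ (norm_nonneg _) (norm_nonneg _), hV] at hgap
    -- The available value of `D(ρ, T)` is in terms of `A`; each summand is pure, so it may be read
    -- off from `B`.
    simp only [norm_bloch_pure] at this
    rwa [hsum, hV, ← max_eq_right hgap] at this

theorem mainTheorem5 (ρ : TwoQubitMatrix) (hρ : IsTwoQubitState ρ) (hrank : ρ.rank = 2) :
    IsLeast (distValues ρ) (dist21 ρ) ∧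
      dist21 ρ = Real.sqrt 2 *
        max (hsNorm (traceA ρ - (1 / 2 : ℂ) • (1 : Matrix (Fin 2) (Fin 2) ℂ)))
          (hsNorm (traceB ρ - (1 / 2 : ℂ) • (1 : Matrix (Fin 2) (Fin 2) ℂ))) := by
  have hH := hρ.posSemidef.isHermitian
  have hleast : IsLeast (distValues ρ) (max ‖bloch pauliA ρ‖ ‖bloch pauliB ρ‖) := by
    refine ⟨max_norm_bloch_mem_distValues hρ.posSemidef hrank, ?_⟩
    rintro _ ⟨K, T, hT, rfl⟩
    exact max_norm_bloch_le_distT hρ.posSemidef hT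
  have hD : dist21 ρ = max ‖bloch pauliA ρ‖ ‖bloch pauliB ρ‖ := hleast.csInf_eq
  refine ⟨hD ▸ hleast, ?_⟩
  rw [hD, mul_max_of_nonneg _ _ (Real.sqrt_nonneg 2), hsNorm_traceA hH hρ.trace_eq_one,
    hsNorm_traceB hH hρ.trace_eq_one, max_comm]
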